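/- Distributed languages and decision. A distributed language is a set $\mathcal L$ of labeled graphs $(G,\ell)$, where $G=(V,E)$ is a finite nonempty simple graph and $\ell:V\to\{0,1\}^*$. Let $N:\mathbb N\to\mathbb N$ be bounded from above by a polynomial, with $N(n)\ge n$ for all $n$. In an $n$-node graph the nodes receive pairwise distinct identifiers in $\{1,\dots,N(n)\}$, and each node initially knows $n$, its own identifier, its own label, and the identifiers of its neighbors. Computation proceeds in synchronous rounds, all nodes run the same algorithm, and local computation is unbounded. In each round of $\mathsf{CONGEST}$, every node sends to each of its neighbors a message (possibly different for different neighbors) of $O(\log n)$ bits. In each round of $\mathsf{BCC}$ (Broadcast Congested Clique), every node sends one and the same message of $O(\log n)$ bits to all the other nodes, whether or not they are its neighbors. Receivers know the identifiers of the senders. (Here $O(\log n)$ stands for at most $c\,(\lfloor\log_2 n\rfloor+1)$ with a constant $c$ depending only on the algorithm.) An algorithm decides $\mathcal L$ if, for every labeled graph $(G,\ell)$ and every assignment of identifiers, $(G,\ell)\in\mathcal L$ if and only if all nodes accept. Let $\mathbf C$ be the class of languages decided by a deterministic $1$-round $\mathsf{CONGEST}$ algorithm, let $\mathbf B^k$ be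 the class of languages decided by a deterministic $k$-round $\mathsf{BCC}$ algorithm, and let $\mathbf B^*=\bigcup_{k\ge 0}\mathbf B^k$. A randomized $\mathsf{BCC}$ algorithm may use random bits, private or shared by all nodes; it decides $\mathcal L$ with error probability at most $\delta$ if, for every labeled graph $(G,\ell)$ and every assignment of identifiers, the event that "$(G,\ell)\in\mathcal L$ if and only if all nodes accept" fails has probability at most $\delta$. Theorem. $\mathbf C\smallsetminus\mathbf B^*\neq\varnothing$. More precisely, for every $N$ as above, the language $$\texttt{disjointness-on-clique}=\big\{(K_n,\ell)\;:\; n\ge 1,\ \ell:V(K_n)\to\{0,1\}^n,\ \forall i\in\{1,\dots,n\}\ \exists v\in V(K_n)\ \ \ell(v)_i=0\big\},$$ where $K_n$ is the $n$-node clique, belongs to $\mathbf C\smallsetminus\mathbf B^*$. Moreover, for every $\varepsilon>0$ and every integer $k\ge 0$, no randomized $k$-round $\mathsf{BCC}$ algorithm decides $\texttt{disjointness-on-clique}$ with error probability at most $\frac12-\varepsilon$. -/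

import Mathlib

namespace HybridModels

/-- A finite nonempty labeled graph `(G, ℓ)`; the vertex set is `Fin n`, and labels are finite
bit strings. -/
structure LabeledGraph where
  n : ℕ
  pos : 0 < n
  graph : SimpleGraph (Fin n)
  label : Fin n → List Bool

/-- A distributed language is a collection of labeled graphs. -/
abbrev DistLanguage := Set LabeledGraph

/-- An admissible bound `N` for identifiers: polynomial in `n`, and leaving room for `n` pairwise
distinct identifiers in `[1, N n]`. -/
def IsIdBound (N : ℕ → ℕ) : Prop :=
  (∀ n, n ≤ N n) ∧ ∃ p : Polynomial ℕ, ∀ n, N n ≤ p.eval n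

/-- An assignment of pairwise distinct identifiers in `[1, N n]` to the nodes of `I`. -/
def IsIdAssignment (N : ℕ → ℕ) (I : LabeledGraph) (id : Fin I.n → ℕ) : Prop :=
  Function.Injective id ∧ ∀ v, 1 ≤ id v ∧ id v ≤ N I.n

/-- What a node knows before any communication: the number of nodes, its own identifier, its own
label, and the identifiers of its neighbors. -/
structure Knowledge where
  size : ℕ
  id : ℕ
  label : List Bool
  nbrs : Finset ℕ

open Classical in
/-- The initial knowledge of node `v`. -/
noncomputable def initialKnowledge (I : LabeledGraph) (id : Fin I.n → ℕ) (v : Fin I.n) :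
    Knowledge where
  size := I.n
  id := id v
  label := I.label v
  nbrs := (Finset.univ.filter fun u => I.graph.Adj v u).image id

/-- Messages are bit strings. -/
abbrev Message := List Bool

/-- What a node receives in one round: the messages, tagged by the senders' identifiers. -/
abbrev Inbox := Finset (ℕ × Message)

/-- The inboxes of all the past rounds, oldest first. -/
abbrev History := List Inbox

/-! Local computation is unbounded, and every node runs the same algorithm, so an algorithm is a
pair of functions of everything a node knows at a given time: one for the messages to be sent in the
next round, one for the decision after the last round. -/

/-- An algorithm for BCC: `send K h` is the message broadcast to all the other nodes. -/
structure BCCAlgorithm where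
  send : Knowledge → History → Message
  accept : Knowledge → History → Bool

/-- An algorithm for CONGEST: `send K h j` is the message for the neighbor of identifier `j`. -/
structure CONGESTAlgorithm where
  send : Knowledge → History → ℕ → Message
  accept : Knowledge → History → Bool

namespace BCCAlgorithm

/-- The inboxes received by each node in the first `t` rounds. -/
noncomputable def history (A : BCCAlgorithm) (I : LabeledGraph) (id : Fin I.n → ℕ) :
    ℕ → Fin I.n → History
  | 0, _ => []
  | t + 1, v => A.history I id t v ++
      [(Finset.univ.filter fun u => u ≠ v).image fun u =>
        (id u, A.send (initialKnowledge I id u) (A.history I id t u))]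

/-- All nodes accept after `t` rounds. -/
def AllAccept (A : BCCAlgorithm) (t : ℕ) (I : LabeledGraph) (id : Fin I.n → ℕ) : Prop :=
  ∀ v, A.accept (initialKnowledge I id v) (A.history I id t v) = true

/-- All messages have at most `c (⌊log₂ n⌋ + 1)` bits in `n`-node networks. -/
def HasBandwidth (A : BCCAlgorithm) (c : ℕ) : Prop :=
  ∀ K h, (A.send K h).length ≤ c * (Nat.log 2 K.size + 1)

end BCCAlgorithm

namespace CONGESTAlgorithm

open Classical in
/-- The inboxes received by each node in the first `t` rounds. -/
noncomputable def history (A : CONGESTAlgorithm) (I : LabeledGraph) (id : Fin I.n → ℕ) :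
    ℕ → Fin I.n → History
  | 0, _ => []
  | t + 1, v => A.history I id t v ++
      [(Finset.univ.filter fun u => I.graph.Adj u v).image fun u =>
        (id u, A.send (initialKnowledge I id u) (A.history I id t u) (id v))]

/-- All nodes accept after `t` rounds. -/
def AllAccept (A : CONGESTAlgorithm) (t : ℕ) (I : LabeledGraph) (id : Fin I.n → ℕ) : Prop :=
  ∀ v, A.accept (initialKnowledge I id v) (A.history I id t v) = true

/-- All messages have at most `c (⌊log₂ n⌋ + 1)` bits in `n`-node networks. -/
def HasBandwidth (A : CONGESTAlgorithm) (c : ℕ) : Prop :=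
  ∀ K h j, (A.send K h j).length ≤ c * (Nat.log 2 K.size + 1)

end CONGESTAlgorithm

/-- `C^t`: the languages decided by a deterministic `t`-round CONGEST algorithm with messages of
`O(log n)` bits, for identifiers in `[1, N n]`. -/
def classC (N : ℕ → ℕ) (t : ℕ) : Set DistLanguage :=
  {L | ∃ A : CONGESTAlgorithm, (∃ c, A.HasBandwidth c) ∧
    ∀ (I : LabeledGraph) (id : Fin I.n → ℕ), IsIdAssignment N I id →
      (I ∈ L ↔ A.AllAccept t I id)}

/-- `B^t`: the languages decided by a deterministic `t`-round BCC algorithm with messages of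
`O(log n)` bits, for identifiers in `[1, N n]`. -/
def classB (N : ℕ → ℕ) (t : ℕ) : Set DistLanguage :=
  {L | ∃ A : BCCAlgorithm, (∃ c, A.HasBandwidth c) ∧
    ∀ (I : LabeledGraph) (id : Fin I.n → ℕ), IsIdAssignment N I id →
      (I ∈ L ↔ A.AllAccept t I id)}

/-- `B^*`, the union of the classes `B^t`. -/
def classBStar (N : ℕ → ℕ) : Set DistLanguage := ⋃ t, classB N t

/-- The languages decided with error probability at most `δ` by a randomized `t`-round BCC algorithm
with messages of `O(log n)` bits. The algorithm is a random choice of a deterministic one, i.e., the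
nodes have access to a random source `ω` common to all of them. Private coins are the special case
where `ω` is a family of independent sources indexed by identifiers, and each node only uses the
source of its own identifier. On every instance the algorithm errs if the nodes do not all accept a
labeled graph in `L`, or all accept a labeled graph not in `L`. -/
def classBRand (N : ℕ → ℕ) (δ : ℝ) (t : ℕ) : Set DistLanguage :=
  {L | ∃ (Ω : Type) (_ : MeasurableSpace Ω) (μ : MeasureTheory.Measure Ω)
      (_ : MeasureTheory.IsProbabilityMeasure μ) (A : Ω → BCCAlgorithm),
    (∃ c, ∀ ω, (A ω).HasBandwidth c) ∧
    ∀ (I : LabeledGraph) (id : Fin I.n → ℕ), IsIdAssignment N I id →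
      MeasurableSet {ω | (A ω).AllAccept t I id} ∧
      μ.real {ω | ¬ (I ∈ L ↔ (A ω).AllAccept t I id)} ≤ δ}

/-- The union over `t` of the classes of `t`-round randomized BCC algorithms of error `δ`. -/
def classBRandStar (N : ℕ → ℕ) (δ : ℝ) : Set DistLanguage := ⋃ t, classBRand N δ t

/-- `disjointness-on-clique`: the graph is the clique on `n` nodes, all labels are in `{0,1}^n`, and
for every `i ∈ [n]` there is a node whose label has `i`-th entry `0`. -/
def disjointnessOnClique : DistLanguage :=
  {I | I.graph = ⊤ ∧ (∀ v, (I.label v).length = I.n) ∧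
    ∀ i < I.n, ∃ v, (I.label v)[i]? = some false}

end HybridModels

/-! In the clique, CONGEST can send each node one column: the node of rank `i` collects the `i`-th
bits of all labels and looks for a `0`. All nodes know all identifiers, so they agree on ranks, and
degrees reveal whether the graph is a clique. For BCC, pointer jumping is embedded in disjointness.
With `m = T + 2`, players `j < m` hold functions `f j` on `K` vertices. Coordinates are the
candidate paths; player `j` puts a `1` where the path respects `f j` and ends at an even vertex.
Some coordinate is all ones iff the true path ends at an even vertex (`pathInstance_mem_iff`). A
`T`-round algorithm becomes a protocol of `T + 1` rounds (`isProtocol_allAccept`), one round short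
of the number of pointers. Such a protocol is almost uncorrelated with the parity of the end
(`abs_sum_chase_mul_le`): each round reveals the next vertex, but only `O(log K)` bits of each later
function, and a function conditioned on an event of not too small probability is still nearly
uniform at most vertices (`sum_dev_le`). Message vectors number polynomially many in `K`, while the
exceptional mass is exponentially small in `K`. Averaging over uniform `f` extends the bound to
randomized algorithms. -/

namespace HybridModels

open Finset

/-! ### Pointer jumping with simultaneous broadcasts. -/

section PointerJumping

variable {V : Type} [Fintype V] [DecidableEq V]

/-- Follow the pointers `f 0, f 1, …` starting from `v`. -/
def chase : (r : ℕ) → V → (Fin r → V → V) → V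
  | 0, v, _ => v
  | r + 1, v, f => chase r (f 0 v) (fun j => f j.succ)

/-- `out` is computed by an `r`-round protocol in which the players, of inputs `f i`, simultaneously
broadcast one element of `M` per round. -/
def IsProtocol (M : Type) {ι X : Type} : (r : ℕ) → ((ι → X) → ℝ) → Prop
  | 0, out => ∃ c : ℝ, |c| ≤ 1 ∧ ∀ f, out f = c
  | r + 1, out => ∃ μ : ι → X → M, ∀ m : ι → M, ∃ out' : (ι → X) → ℝ,
      IsProtocol M r out' ∧ ∀ f, (∀ i, μ i (f i) = m i) → out f = out' f

/-- Fixing the input of the first player yields a protocol for the other ones. -/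
theorem IsProtocol.cons {M X : Type} (x : X) {k : ℕ} : ∀ {r : ℕ} {out : (Fin (k + 1) → X) → ℝ},
    IsProtocol M r out →
      IsProtocol M r (fun g : Fin k → X => out (Fin.cons (α := fun _ => X) x g))
  | 0, _, ⟨c, hc, h⟩ => ⟨c, hc, fun _ => h _⟩
  | r + 1, out, ⟨μ, h⟩ => by
      refine ⟨fun j => μ j.succ, fun m => ?_⟩
      obtain ⟨out', h', e⟩ := h (Fin.cons (α := fun _ => M) (μ 0 x) m)
      refine ⟨_, h'.cons x, fun g hg => e _ fun i => ?_⟩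
      refine Fin.cases ?_ (fun j => ?_) i
      · simp
      · simpa using hg j

/-- The deviation from uniform of the value at `v` of a random function of density `w`. -/
noncomputable def dev (w : (V → V) → ℝ) (v : V) : ℝ :=
  ∑ u, |∑ f, w f * ((if f v = u then 1 else 0) - 1 / (Fintype.card V : ℝ))|

theorem dev_nonneg (w : (V → V) → ℝ) (v : V) : 0 ≤ dev w v :=
  sum_nonneg fun _ _ => abs_nonneg _

/-- Splits the law of `f v` into its uniform part and its fluctuation, the latter being what `dev`
measures. -/
theorem sum_mul_apply_eq (w : (V → V) → ℝ) (v : V) (D : V → ℝ) :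
    ∑ f, w f * D (f v) = (∑ f, w f) * (∑ u, D u) / Fintype.card V +
      ∑ u, D u * ∑ f, w f * ((if f v = u then 1 else 0) - 1 / (Fintype.card V : ℝ)) := by
  have h : ∀ f : V → V, w f * D (f v) = ∑ u, D u * (w f * (if f v = u then 1 else 0)) := by
    intro f
    simp [mul_comm]
  have h2 : ∀ u, D u * ∑ f, w f * ((if f v = u then 1 else 0) - 1 / (Fintype.card V : ℝ)) =
      ∑ f, D u * (w f * (if f v = u then 1 else 0)) - (∑ f, w f) * D u / Fintype.card V := by
    intro u
    rw [← mul_sum]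
    simp only [mul_sub, sum_sub_distrib, ← sum_mul]
    ring
  simp only [h, h2, sum_sub_distrib]
  rw [sum_comm, mul_sum, sum_div]
  ring

theorem sum_mul_apply_le (w : (V → V) → ℝ) (v : V) (D : V → ℝ) (B : ℝ) (hD : ∀ u, |D u| ≤ B) :
    ∑ f, w f * D (f v) ≤ (∑ f, w f) * (∑ u, D u) / Fintype.card V + B * dev w v := by
  rw [sum_mul_apply_eq]
  refine add_le_add le_rfl ?_
  unfold dev
  rw [mul_sum univ _ B]
  refine sum_le_sum fun u _ => (le_abs_self _).trans ?_
  rw [abs_mul]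
  exact mul_le_mul_of_nonneg_right (hD u) (abs_nonneg _)

theorem dev_le [Nonempty V] (w : (V → V) → ℝ) (hw : ∀ f, 0 ≤ w f) (v : V) :
    dev w v ≤ 2 * ∑ f, w f := by
  have hK : (0 : ℝ) < Fintype.card V := by exact_mod_cast Fintype.card_pos
  have h : ∀ u, |∑ f, w f * ((if f v = u then 1 else 0) - 1 / (Fintype.card V : ℝ))| ≤
      ∑ f, w f * ((if f v = u then 1 else 0) + 1 / (Fintype.card V : ℝ)) := by
    intro u
    refine (abs_sum_le_sum_abs _ _).trans (sum_le_sum fun f _ => ?_)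
    rw [abs_mul, abs_of_nonneg (hw f)]
    refine mul_le_mul_of_nonneg_left ?_ (hw f)
    refine (abs_sub _ _).trans ?_
    rw [abs_of_nonneg (by positivity : (0 : ℝ) ≤ 1 / (Fintype.card V : ℝ))]
    split_ifs <;> simp
  refine (sum_le_sum fun u _ => h u).trans ?_
  rw [sum_comm, mul_sum]
  refine sum_le_sum fun f _ => ?_
  rw [← mul_sum, sum_add_distrib]
  simp
  linarith

/-- A subgaussian exponential moment bound for sums of independent centered variables. -/
theorem sum_exp_le [Nonempty V] (h : V → V → ℝ) (hb : ∀ v u, |h v u| ≤ 2) (h0 : ∀ v, ∑ u, h v u = 0)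
    (l : ℝ) (hl0 : 0 ≤ l) (hl : l ≤ 1 / 2) :
    ∑ f : V → V, Real.exp (l * ∑ v, h v (f v)) ≤
      Fintype.card (V → V) * Real.exp (4 * l ^ 2 * Fintype.card V) := by
  have e1 : ∀ f : V → V, Real.exp (l * ∑ v, h v (f v)) = ∏ v, Real.exp (l * h v (f v)) := by
    intro f
    rw [mul_sum, Real.exp_sum]
  have e2 : ∀ v, ∑ u, Real.exp (l * h v u) ≤ Fintype.card V * Real.exp (4 * l ^ 2) := by
    intro v
    -- From `exp x ≤ 1 + x + x ^ 2` for `|x| ≤ 1`; the linear term vanishes on summing over `u`.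
    have : ∀ u, Real.exp (l * h v u) ≤ 1 + l * h v u + 4 * l ^ 2 := by
      intro u
      have hx : |l * h v u| ≤ 1 := by
        rw [abs_mul, abs_of_nonneg hl0]
        nlinarith [hb v u, abs_nonneg (h v u)]
      have h1 := (abs_le.1 (Real.abs_exp_sub_one_sub_id_le hx)).2
      have h2 : (h v u) ^ 2 ≤ 4 := by
        have := sq_le_sq' (by linarith [(abs_le.1 (hb v u)).1]) (abs_le.1 (hb v u)).2
        linarith
      nlinarith [sq_nonneg l]
    refine (sum_le_sum fun u _ => this u).trans ?_
    rw [sum_add_distrib, sum_add_distrib, ← mul_sum, h0]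
    simp only [sum_const, card_univ, nsmul_eq_mul]
    have := Real.add_one_le_exp (4 * l ^ 2)
    have hK : (0 : ℝ) ≤ Fintype.card V := by positivity
    nlinarith
  simp only [e1]
  rw [← Fintype.piFinset_univ, ← Finset.prod_univ_sum (fun _ => univ)
    (fun v u => Real.exp (l * h v u))]
  refine (prod_le_prod (fun v _ => by positivity) fun v _ => e2 v).trans ?_
  rw [prod_const, card_univ, mul_pow, ← Real.exp_nat_mul]
  simp [mul_comm]

/-- A random function of not too small density has almost uniform values at most points. -/
theorem sum_dev_le [Nonempty V] (t : ℝ) (ht : 0 < t) (ht1 : t ≤ 1) (w : (V → V) → ℝ)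
    (hw0 : ∀ f, 0 ≤ w f) (hw1 : ∀ f, w f ≤ 1) :
    ∑ v, dev w v ≤ Fintype.card V * (t * ∑ f, w f +
      8 / t * Real.exp (-(t ^ 2 * Fintype.card V / 16)) * Fintype.card (V → V)) := by
  set K : ℝ := (Fintype.card V : ℝ) with hK
  have hK1 : 1 ≤ K := by
    rw [hK]; exact_mod_cast Fintype.card_pos (α := V)
  set a : V → V → ℝ := fun v u => ∑ f, w f * ((if f v = u then 1 else 0) - 1 / K) with ha
  -- Signs linearize the absolute values in `dev`; centering them costs nothing because `a v` sums
  -- to `0`.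
  set s : V → V → ℝ := fun v u => if 0 ≤ a v u then 1 else -1 with hs
  have hsb : ∀ v u, |s v u| ≤ 1 := by
    intro v u; simp only [hs]; split_ifs <;> simp
  set h : V → V → ℝ := fun v u => s v u - (∑ u', s v u') / K with hh
  have hm : ∀ v, |(∑ u', s v u') / K| ≤ 1 := by
    intro v
    rw [abs_div, abs_of_pos (by linarith : 0 < K), div_le_one (by linarith)]
    refine (abs_sum_le_sum_abs _ _).trans ((sum_le_sum fun u _ => hsb v u).trans ?_)
    simp [hK]
  have hb : ∀ v u, |h v u| ≤ 2 := by
    intro v u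
    refine (abs_sub _ _).trans ?_
    linarith [hsb v u, hm v]
  have h0 : ∀ v, ∑ u, h v u = 0 := by
    intro v
    simp only [hh, sum_sub_distrib, sum_const, card_univ, nsmul_eq_mul, ← hK]
    field_simp
    ring
  have hdev : ∀ v, dev w v = ∑ f, w f * h v (f v) := by
    intro v
    have e := sum_mul_apply_eq w v (h v)
    rw [h0] at e
    rw [e]
    simp only [mul_zero, zero_div, zero_add, dev]
    have e3 : ∑ u, a v u = 0 := by
      simp only [ha]
      rw [sum_comm]
      refine sum_eq_zero fun f _ => ?_
      rw [← mul_sum, sum_sub_distrib]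
      simp [← hK]
    have e4 : ∀ u, h v u * a v u = |a v u| - (∑ u', s v u') / K * a v u := by
      intro u
      simp only [hh, sub_mul]
      congr 1
      simp only [hs]
      split_ifs with h1
      · rw [abs_of_nonneg h1, one_mul]
      · rw [abs_of_neg (not_le.1 h1)]; ring
    change ∑ u, |a v u| = ∑ u, h v u * a v u
    simp only [e4, sum_sub_distrib, ← mul_sum, e3]
    ring
  have hl : 0 < t / 8 := by positivity
  -- This is `y + 1 ≤ exp y` with `y = l * (S - t * K)` and `l = t / 8`, where `S` is the left-hand
  -- sum. The moment bound then costs `4 * l ^ 2 * K = t ^ 2 * K / 16`, half of the gain `l * t *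
  -- K`.
  have hS : ∀ f : V → V, ∑ v, h v (f v) ≤
      t * K + 8 / t * (Real.exp (-(t ^ 2 * K / 8)) * Real.exp (t / 8 * ∑ v, h v (f v))) := by
    intro f
    rw [← Real.exp_add]
    have := Real.add_one_le_exp (-(t ^ 2 * K / 8) + t / 8 * ∑ v, h v (f v))
    have h2 : 8 / t * (-(t ^ 2 * K / 8) + t / 8 * ∑ v, h v (f v)) =
        -(t * K) + ∑ v, h v (f v) := by
      field_simp
    have h3 : 8 / t * (-(t ^ 2 * K / 8) + t / 8 * ∑ v, h v (f v)) ≤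
        8 / t * Real.exp (-(t ^ 2 * K / 8) + t / 8 * ∑ v, h v (f v)) :=
      mul_le_mul_of_nonneg_left (by linarith) (by positivity)
    linarith
  calc ∑ v, dev w v = ∑ f, w f * ∑ v, h v (f v) := by
        simp only [hdev, mul_sum]
        rw [sum_comm]
    _ ≤ ∑ f, (w f * (t * K) +
        8 / t * (Real.exp (-(t ^ 2 * K / 8)) * Real.exp (t / 8 * ∑ v, h v (f v)))) := by
        refine sum_le_sum fun f _ => ?_
        refine (mul_le_mul_of_nonneg_left (hS f) (hw0 f)).trans ?_
        rw [mul_add]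
        exact add_le_add le_rfl (mul_le_of_le_one_left (by positivity) (hw1 f))
    _ = t * K * (∑ f, w f) + 8 / t * (Real.exp (-(t ^ 2 * K / 8)) *
        ∑ f : V → V, Real.exp (t / 8 * ∑ v, h v (f v))) := by
        rw [sum_add_distrib, ← sum_mul, ← mul_sum, ← mul_sum]
        ring
    _ ≤ t * K * (∑ f, w f) + 8 / t * (Real.exp (-(t ^ 2 * K / 8)) *
        (Fintype.card (V → V) * Real.exp (4 * (t / 8) ^ 2 * K))) := by
        gcongr
        exact sum_exp_le h hb h0 (t / 8) hl.le (by linarith)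
    _ = t * K * (∑ f, w f) + 1 * (8 / t * Real.exp (-(t ^ 2 * K / 16)) *
        Fintype.card (V → V)) := by
        have : Real.exp (-(t ^ 2 * K / 16)) =
            Real.exp (-(t ^ 2 * K / 8)) * Real.exp (4 * (t / 8) ^ 2 * K) := by
          rw [← Real.exp_add]; congr 1; ring
        rw [this]; ring
    _ ≤ t * K * (∑ f, w f) + K * (8 / t * Real.exp (-(t ^ 2 * K / 16)) *
        Fintype.card (V → V)) := by
        gcongr
    _ = _ := by ring

theorem sum_fin_succ_fun {X : Type} [Fintype X] {k : ℕ} (F : (Fin (k + 1) → X) → ℝ) :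
    ∑ f, F f = ∑ x, ∑ g : Fin k → X, F (Fin.cons (α := fun _ => X) x g) := by
  rw [← Fintype.sum_prod_type']
  exact ((Fin.consEquiv fun _ => X).sum_comp F).symm

/-- Message vectors partition the inputs into rectangles, so conditioning on them preserves product
densities. -/
theorem sum_prod_ite {M X : Type} [Fintype M] [DecidableEq M] {k : ℕ}
    (μ : Fin k → X → M) (w : Fin k → X → ℝ) (g : Fin k → X) (G : (Fin k → M) → ℝ) :
    ∑ m : Fin k → M, (∏ j, if μ j (g j) = m j then w j (g j) else 0) * G m =
      (∏ j, w j (g j)) * G fun j => μ j (g j) := by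
  rw [sum_eq_single fun j => μ j (g j)]
  · simp
  · intro m _ hm
    obtain ⟨j, hj⟩ := Function.ne_iff.1 hm
    rw [prod_eq_zero (mem_univ j), zero_mul]
    rw [if_neg (Ne.symm hj)]
  · simp

/-- A protocol with as many rounds as there are pointers to follow after the first one has small
correlation with any balanced function `χ` of the end point. -/
theorem abs_sum_chase_mul_le [Nonempty V] {M : Type} [Fintype M] [DecidableEq M] [Nonempty M]
    (χ : V → ℝ) (h1 : ∀ u, |χ u| ≤ 1) (h0 : ∑ u, χ u = 0) (t θ : ℝ) (ht : 0 ≤ t) (hθ : 0 ≤ θ)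
    (H : ∀ w : (V → V) → ℝ, (∀ f, 0 ≤ w f) → (∀ f, w f ≤ 1) →
      ∑ v, dev w v ≤ Fintype.card V * (t * ∑ f, w f + θ * Fintype.card (V → V))) :
    ∀ (r : ℕ) (v : V) (w : Fin (r + 1) → (V → V) → ℝ) (out : (Fin (r + 1) → V → V) → ℝ),
      (∀ j f, 0 ≤ w j f) → (∀ j f, w j f ≤ 1) → IsProtocol M r out →
      |∑ f, (∏ j, w j (f j)) * (χ (chase (r + 1) v f) * out f)| ≤
        2 ^ r * dev (w 0) v * ∏ j : Fin r, ∑ f, w j.succ f +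
        2 ^ r * t * ∏ j, ∑ f, w j f +
        2 ^ r * θ * (Fintype.card M : ℝ) ^ ((r + 1) ^ 2) *
          (Fintype.card (V → V) : ℝ) ^ (r + 1) := by
  have hK : (0 : ℝ) < Fintype.card V := by exact_mod_cast Fintype.card_pos
  have hL : (1 : ℝ) ≤ Fintype.card M := by exact_mod_cast Fintype.card_pos (α := M)
  set F : ℝ := (Fintype.card (V → V) : ℝ) with hF
  set L : ℝ := (Fintype.card M : ℝ) with hLdef
  have hF0 : 0 ≤ F := by positivity
  have hmass : ∀ w : (V → V) → ℝ, (∀ f, w f ≤ 1) → ∑ f, w f ≤ F := by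
    intro w hw
    refine (sum_le_sum fun f _ => hw f).trans ?_
    simp [hF]
  intro r
  induction r with
  | zero =>
    rintro v w out hw0 hw1 ⟨c, hc, hout⟩
    have e : ∑ f, (∏ j, w j (f j)) * (χ (chase (0 + 1) v f) * out f) =
        c * ∑ f, w 0 f * χ (f v) := by
      rw [sum_fin_succ_fun, mul_sum]
      refine sum_congr rfl fun f _ => ?_
      simp [chase, hout]
      ring
    rw [e, sum_mul_apply_eq, h0, abs_mul]
    have : |∑ u, χ u * ∑ f, w 0 f * ((if f v = u then 1 else 0) - 1 / (Fintype.card V : ℝ))| ≤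
        dev (w 0) v := by
      refine (abs_sum_le_sum_abs _ _).trans (sum_le_sum fun u _ => ?_)
      rw [abs_mul]
      exact mul_le_of_le_one_left (abs_nonneg _) (h1 u)
    have h2 : 0 ≤ ∑ f, w 0 f := sum_nonneg fun f _ => hw0 0 f
    have h3 : 0 ≤ θ * L * F := by positivity
    have h4 : 0 ≤ t * ∑ f, w 0 f := by positivity
    have h5 := mul_le_mul hc this (abs_nonneg _) zero_le_one
    rw [one_mul] at h5
    simp only [mul_zero, zero_div, zero_add]
    refine h5.trans ?_
    simp
    linarith
  | succ r ih =>
    rintro v w out hw0 hw1 ⟨μ, hμ⟩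
    choose cont hcont hout using hμ
    -- The later players are conditioned on their messages `m`. The first player's input is fixed
    -- instead, which determines both its message and the next vertex.
    set w' : (Fin (r + 1) → M) → Fin (r + 1) → (V → V) → ℝ :=
      fun m j f => if μ j.succ f = m j then w j.succ f else 0 with hw'
    have hw'0 : ∀ m j f, 0 ≤ w' m j f := by
      intro m j f; simp only [hw']; split_ifs
      · exact hw0 _ _
      · exact le_rfl
    have hw'1 : ∀ m j f, w' m j f ≤ 1 := by
      intro m j f; simp only [hw']; split_ifs
      · exact hw1 _ _
      · exact zero_le_one
    set P : (Fin (r + 1) → M) → ℝ := fun m => ∏ j : Fin r, ∑ f, w' m j.succ f with hP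
    set Q : (Fin (r + 1) → M) → ℝ := fun m => ∏ j : Fin (r + 1), ∑ f, w' m j f with hQ
    have hPQ : ∀ m, (∑ f, w' m 0 f) * P m = Q m := by
      intro m; simp only [hP, hQ]; rw [Fin.prod_univ_succ]
    have hP0 : ∀ m, 0 ≤ P m := fun m =>
      prod_nonneg fun j _ => sum_nonneg fun f _ => hw'0 _ _ _
    have hPF : ∀ m, P m ≤ F ^ r := by
      intro m
      have := prod_le_prod (s := (univ : Finset (Fin r)))
        (fun j _ => sum_nonneg fun f _ => hw'0 m j.succ f) fun j _ => hmass _ (hw'1 m j.succ)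
      simpa using this
    have hQsum : ∑ m, Q m = ∏ j : Fin (r + 1), ∑ f, w j.succ f := by
      have : ∀ j : Fin (r + 1), ∑ f, w j.succ f =
          ∑ a : M, ∑ f, (if μ j.succ f = a then w j.succ f else 0) := by
        intro j
        rw [sum_comm]
        simp
      simp only [this]
      rw [Finset.prod_univ_sum, Fintype.piFinset_univ]
    set W := ∑ f, w 0 f with hW
    have hW0 : 0 ≤ W := sum_nonneg fun f _ => hw0 _ _
    have hWF : W ≤ F := hmass _ (hw1 0)
    set X : (Fin (r + 1) → M) → (V → V) → (Fin (r + 1) → V → V) → ℝ := fun m f g =>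
      cont (Fin.cons (α := fun _ => M) (μ 0 f) m) (Fin.cons (α := fun _ => V → V) f g) with hX
    have hXp : ∀ m f, IsProtocol M r (X m f) := fun m f => (hcont _).cons f
    have key : ∑ f, (∏ j, w j (f j)) * (χ (chase (r + 1 + 1) v f) * out f) =
        ∑ m, ∑ f, w 0 f * ∑ g : Fin (r + 1) → V → V,
          (∏ j, w' m j (g j)) * (χ (chase (r + 1) (f v) g) * X m f g) := by
      rw [sum_fin_succ_fun, sum_comm (s := (univ : Finset (Fin (r + 1) → M)))]
      refine sum_congr rfl fun f _ => ?_
      rw [← mul_sum, sum_comm, mul_sum]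
      refine sum_congr rfl fun g _ => ?_
      have := sum_prod_ite (fun j => μ j.succ) (fun j => w j.succ) g
        (fun m => χ (chase (r + 1) (f v) g) * X m f g)
      rw [this, Fin.prod_univ_succ]
      simp only [Fin.cons_zero, Fin.cons_succ, chase, hX]
      rw [← hout (Fin.cons (α := fun _ => M) (μ 0 f) fun j => μ j.succ (g j))
        (Fin.cons (α := fun _ => V → V) f g)
        (fun i => by refine Fin.cases ?_ (fun j => ?_) i <;> simp)]
      ring
    rw [key]
    have step : ∀ m, |∑ f, w 0 f * ∑ g : Fin (r + 1) → V → V,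
          (∏ j, w' m j (g j)) * (χ (chase (r + 1) (f v) g) * X m f g)| ≤
        2 ^ (r + 1) * dev (w 0) v * Q m + 2 ^ (r + 1) * t * (W * Q m) +
          2 ^ (r + 1) * θ * L ^ ((r + 1) ^ 2) * F ^ (r + 1 + 1) := by
      intro m
      have b1 : ∀ f, |w 0 f * ∑ g : Fin (r + 1) → V → V,
          (∏ j, w' m j (g j)) * (χ (chase (r + 1) (f v) g) * X m f g)| ≤
          2 ^ r * P m * (w 0 f * dev (w' m 0) (f v)) + (2 ^ r * t * Q m +
            2 ^ r * θ * L ^ ((r + 1) ^ 2) * F ^ (r + 1)) * w 0 f := by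
        intro f
        rw [abs_mul, abs_of_nonneg (hw0 0 f)]
        refine (mul_le_mul_of_nonneg_left
          (ih (f v) (w' m) (X m f) (hw'0 m) (hw'1 m) (hXp m f)) (hw0 0 f)).trans (le_of_eq ?_)
        simp only [hP, hQ]
        ring
      refine (abs_sum_le_sum_abs _ _).trans ((sum_le_sum fun f _ => b1 f).trans ?_)
      rw [sum_add_distrib, ← mul_sum, ← mul_sum]
      -- The next vertex `f v` is replaced by a uniform one at the price of `dev (w 0) v`; at a
      -- uniform vertex, `H` bounds the new deviation.
      have b2 := sum_mul_apply_le (w 0) v (dev (w' m 0)) (2 * ∑ f, w' m 0 f) (fun u => by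
        rw [abs_of_nonneg (dev_nonneg _ _)]; exact dev_le _ (hw'0 m 0) u)
      have b3 : (∑ f, w 0 f) * (∑ u, dev (w' m 0) u) / Fintype.card V ≤
          W * (t * ∑ f, w' m 0 f + θ * F) := by
        rw [div_le_iff₀ hK, mul_assoc]
        refine mul_le_mul_of_nonneg_left ?_ hW0
        rw [mul_comm _ (Fintype.card V : ℝ)]
        exact H _ (hw'0 m 0) (hw'1 m 0)
      have b4 := mul_le_mul_of_nonneg_left (b2.trans (add_le_add_left b3 _))
        (by have := hP0 m; positivity : 0 ≤ 2 ^ r * P m)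
      have b5 : 2 ^ r * P m * (W * (t * ∑ f, w' m 0 f + θ * F) +
          2 * (∑ f, w' m 0 f) * dev (w 0) v) =
          2 ^ r * t * (W * Q m) + 2 ^ r * θ * (P m * (W * F)) +
            2 ^ (r + 1) * dev (w 0) v * Q m := by
        rw [← hPQ]; ring
      have b6 : 2 ^ r * θ * (P m * (W * F)) ≤ 2 ^ r * θ * L ^ ((r + 1) ^ 2) * F ^ (r + 1 + 1) := by
        have c1 : P m * (W * F) ≤ F ^ r * (F * F) := by
          gcongr
          exact hPF m
        have c2 : (1 : ℝ) ≤ L ^ ((r + 1) ^ 2) := one_le_pow₀ hL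
        calc 2 ^ r * θ * (P m * (W * F)) ≤ 2 ^ r * θ * (F ^ r * (F * F)) := by gcongr
          _ = 2 ^ r * θ * 1 * F ^ (r + 1 + 1) := by ring
          _ ≤ _ := by gcongr
      have b7 : (2 ^ r * θ * L ^ ((r + 1) ^ 2) * F ^ (r + 1)) * W ≤
          2 ^ r * θ * L ^ ((r + 1) ^ 2) * F ^ (r + 1 + 1) := by
        rw [pow_succ F (r + 1), ← mul_assoc]
        gcongr
      rw [b5] at b4
      have b8 : (2 : ℝ) ^ (r + 1) = 2 * 2 ^ r := by ring
      calc _ ≤ 2 ^ r * t * (W * Q m) + 2 ^ r * θ * (P m * (W * F)) +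
            2 ^ (r + 1) * dev (w 0) v * Q m + (2 ^ r * t * Q m +
            2 ^ r * θ * L ^ ((r + 1) ^ 2) * F ^ (r + 1)) * W := add_le_add_left b4 _
        _ = 2 ^ (r + 1) * dev (w 0) v * Q m + 2 ^ (r + 1) * t * (W * Q m) +
            (2 ^ r * θ * (P m * (W * F)) +
              (2 ^ r * θ * L ^ ((r + 1) ^ 2) * F ^ (r + 1)) * W) := by rw [b8]; ring
        _ ≤ 2 ^ (r + 1) * dev (w 0) v * Q m + 2 ^ (r + 1) * t * (W * Q m) +
            (2 ^ r * θ * L ^ ((r + 1) ^ 2) * F ^ (r + 1 + 1) +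
              2 ^ r * θ * L ^ ((r + 1) ^ 2) * F ^ (r + 1 + 1)) := by gcongr
        _ = _ := by rw [b8]; ring
    refine (abs_sum_le_sum_abs _ _).trans ((sum_le_sum fun m _ => step m).trans ?_)
    rw [sum_add_distrib, sum_add_distrib, ← mul_sum, ← mul_sum, ← mul_sum, hQsum,
      Fin.prod_univ_succ (n := r + 1)]
    refine add_le_add le_rfl ?_
    simp only [sum_const, card_univ, nsmul_eq_mul, Fintype.card_fun, Fintype.card_fin, Nat.cast_pow,
      ← hLdef]
    -- The additive error is paid once per message vector, hence the factor `L ^ (r + 1)`.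
    have c3 : L ^ (r + 1) * L ^ ((r + 1) ^ 2) ≤ L ^ ((r + 1 + 1) ^ 2) := by
      rw [← pow_add]
      exact pow_le_pow_right₀ hL (by nlinarith)
    calc L ^ (r + 1) * (2 ^ (r + 1) * θ * L ^ ((r + 1) ^ 2) * F ^ (r + 1 + 1))
        = 2 ^ (r + 1) * θ * (L ^ (r + 1) * L ^ ((r + 1) ^ 2)) * F ^ (r + 1 + 1) := by ring
      _ ≤ _ := by gcongr

end PointerJumping

/-! ### From BCC algorithms to protocols. -/

/-- The word of length `b` over `Option Bool` that stands for a bit string of length at most `b`. -/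
def encodeMessage (b : ℕ) (l : Message) : Fin b → Option Bool := fun i => l[i.val]?

theorem encodeMessage_inj {b : ℕ} {l l' : Message} (h : l.length ≤ b) (h' : l'.length ≤ b)
    (e : encodeMessage b l = encodeMessage b l') : l = l' := by
  refine List.ext_getElem? fun i => ?_
  by_cases hi : i < b
  · exact congrFun e ⟨i, hi⟩
  · rw [List.getElem?_eq_none (by omega), List.getElem?_eq_none (by omega)]

namespace BCCAlgorithm

/-- One round of `A` on nodes of initial knowledge `κ`, from the histories `H`. -/
noncomputable def step {n : ℕ} (A : BCCAlgorithm) (κ : Fin n → Knowledge) (id : Fin n → ℕ)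
    (H : Fin n → History) : Fin n → History := fun v =>
  H v ++ [(univ.filter fun u => u ≠ v).image fun u => (id u, A.send (κ u) (H u))]

/-- `history` peels off the last round, protocols the first; iterates of `step` allow both. -/
theorem history_eq_iterate (A : BCCAlgorithm) (I : LabeledGraph) (id : Fin I.n → ℕ) (t : ℕ) :
    A.history I id t = (A.step (initialKnowledge I id) id)^[t] fun _ => [] := by
  induction t with
  | zero => rfl
  | succ t ih =>
    rw [Function.iterate_succ_apply', ← ih]
    rfl

theorem step_congr {n : ℕ} (A : BCCAlgorithm) {κ κ' : Fin n → Knowledge} (id : Fin n → ℕ)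
    {H : Fin n → History} (h : ∀ u, A.send (κ u) (H u) = A.send (κ' u) (H u)) :
    A.step κ id H = A.step κ' id H := by
  unfold step
  simp only [h]

open Classical in
/-- If all the input is held by the nodes `node j`, then a BCC algorithm amounts to a protocol
between these nodes, with one more round for the decision. -/
theorem isProtocol_allAccept {n : ℕ} {ι X : Type} (A : BCCAlgorithm) (c : ℕ)
    (hA : A.HasBandwidth c) (id : Fin n → ℕ) (κ : (ι → X) → Fin n → Knowledge)
    (hsize : ∀ f v, (κ f v).size = n) (node : ι → Fin n) (hnode : Function.Injective node)
    (hκ : ∀ f f' v, (∀ j, node j = v → f j = f' j) → κ f v = κ f' v) :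
    ∀ (s : ℕ) (H : Fin n → History),
      IsProtocol (Fin (c * (Nat.log 2 n + 1) + 1) → Option Bool) (s + 1)
        (fun f => if ∀ v, A.accept (κ f v) ((A.step (κ f) id)^[s] H v) = true
          then (1 : ℝ) else -1) := by
  -- The final `+ 1` leaves room for the decision bit even if `c = 0`.
  set b := c * (Nat.log 2 n + 1) + 1 with hb
  have own : ∀ (f : ι → X) j, κ f (node j) = κ (fun _ => f j) (node j) := by
    intro f j
    refine hκ _ _ _ fun j' hj' => ?_
    rw [hnode hj']
  have agree : ∀ (Φ : Knowledge → History → Message) (H : Fin n → History),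
      (∀ f v, (Φ (κ f v) (H v)).length ≤ b) → ∀ f f' : ι → X,
      (∀ j, encodeMessage b (Φ (κ (fun _ => f j) (node j)) (H (node j))) =
        encodeMessage b (Φ (κ (fun _ => f' j) (node j)) (H (node j)))) →
      ∀ v, Φ (κ f v) (H v) = Φ (κ f' v) (H v) := by
    intro Φ H hΦ f f' h v
    by_cases hv : ∃ j, node j = v
    · obtain ⟨j, rfl⟩ := hv
      have := h j
      rw [← own, ← own] at this
      exact encodeMessage_inj (hΦ _ _) (hΦ _ _) this
    · rw [hκ f f' v fun j hj => (hv ⟨j, hj⟩).elim]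
  intro s
  induction s with
  | zero =>
    intro H
    refine ⟨fun j x => encodeMessage b [A.accept (κ (fun _ => x) (node j)) (H (node j))],
      fun m => ?_⟩
    by_cases hm : ∃ f : ι → X, ∀ j,
        encodeMessage b [A.accept (κ (fun _ => f j) (node j)) (H (node j))] = m j
    · obtain ⟨f₀, hf₀⟩ := hm
      refine ⟨fun _ => if ∀ v, A.accept (κ f₀ v) (H v) = true then (1 : ℝ) else -1,
        ⟨_, ?_, fun _ => rfl⟩, fun f hf => ?_⟩
      · split_ifs <;> simp
      · have := agree (fun k h => [A.accept k h]) H (fun _ _ => by simp [hb]) f f₀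
          (fun j => (hf j).trans (hf₀ j).symm)
        simp only [List.cons.injEq, and_true] at this
        simp only [Function.iterate_zero, id_eq, this]
    · exact ⟨fun _ => 0, ⟨0, by simp, fun _ => rfl⟩, fun f hf => (hm ⟨f, hf⟩).elim⟩
  | succ s ih =>
    intro H
    refine ⟨fun j x => encodeMessage b (A.send (κ (fun _ => x) (node j)) (H (node j))),
      fun m => ?_⟩
    by_cases hm : ∃ f : ι → X, ∀ j,
        encodeMessage b (A.send (κ (fun _ => f j) (node j)) (H (node j))) = m j
    -- Any input `f₀` producing the messages `m` yields the same next histories as `f`, so it can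
    -- define the continuation.
    · obtain ⟨f₀, hf₀⟩ := hm
      refine ⟨_, ih (A.step (κ f₀) id H), fun f hf => ?_⟩
      have := A.step_congr id (agree A.send H (fun f v => by
        have := hA (κ f v) (H v)
        rw [hsize] at this
        omega) f f₀ (fun j => (hf j).trans (hf₀ j).symm))
      simp only [Function.iterate_succ_apply, this]
    · exact ⟨_, ih H, fun f hf => (hm ⟨f, hf⟩).elim⟩

end BCCAlgorithm

/-! ### Embedding pointer jumping into disjointness. -/

section PathInstance

variable {V : Type}

/-- `a` is the sequence of the vertices reached from `v` along the pointers `f 0, f 1, …`. -/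
def IsPath {m : ℕ} (v : V) (f : Fin m → V → V) (a : Fin m → V) : Prop :=
  ∀ j, f j ((Fin.cons v a : Fin (m + 1) → V) j.castSucc) = a j

theorem exists_isPath : ∀ {m : ℕ} (v : V) (f : Fin m → V → V), ∃ a, IsPath v f a
  | 0, _, _ => ⟨Fin.elim0, fun j => j.elim0⟩
  | m + 1, v, f => by
      obtain ⟨a, ha⟩ := exists_isPath (f 0 v) fun j => f j.succ
      refine ⟨Fin.cons (f 0 v) a, fun j => ?_⟩
      refine Fin.cases ?_ (fun j => ?_) j
      · simp
      · simpa using ha j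

theorem IsPath.last : ∀ {m : ℕ} {v : V} {f : Fin m → V → V} {a : Fin m → V}, IsPath v f a →
    (Fin.cons v a : Fin (m + 1) → V) (Fin.last m) = chase m v f
  | 0, _, _, _, _ => rfl
  | m + 1, v, f, a, h => by
      have h0 : a 0 = f 0 v := (h 0).symm
      have h' : IsPath (f 0 v) (fun j => f j.succ) (fun j => a j.succ) := by
        intro j
        have := h j.succ
        have e : (Fin.cons (f 0 v) (fun j => a j.succ) : Fin (m + 1) → V) = a := by
          rw [← h0]; exact Fin.cons_self_tail a
        rw [← Fin.succ_castSucc, Fin.cons_succ] at this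
        rw [e]
        exact this
      have := h'.last
      rw [chase, ← this, ← h0]
      rw [show (Fin.cons (a 0) (fun j => a j.succ) : Fin (m + 1) → V) = a from Fin.cons_self_tail a,
        ← Fin.succ_last, Fin.cons_succ]

open Classical in
/-- The clique on `K ^ m` nodes, whose coordinates are the sequences `a` of `m` vertices. For
`j < m`, the label of the node `j` has a `1` at `a` if the pointer `f j` is compatible with `a` and
the end of `a` is even. The labels of the other nodes are all-ones. -/
noncomputable def pathInstance (K m : ℕ) (hK : 0 < K) (v : Fin K) (f : Fin m → Fin K → Fin K) :
    LabeledGraph where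
  n := K ^ m
  pos := pow_pos hK m
  graph := ⊤
  label u := List.ofFn fun i : Fin (K ^ m) => decide (∀ j : Fin m, j.val = u.val →
    f j ((Fin.cons v (finFunctionFinEquiv.symm i) : Fin (m + 1) → Fin K) j.castSucc) =
      finFunctionFinEquiv.symm i j ∧
    Even ((Fin.cons v (finFunctionFinEquiv.symm i) : Fin (m + 1) → Fin K) (Fin.last m)).val)

theorem pathInstance_mem_iff (K m : ℕ) (hK : 0 < K) (hm : 0 < m) (hmK : m ≤ K ^ m) (v : Fin K)
    (f : Fin m → Fin K → Fin K) :
    pathInstance K m hK v f ∈ disjointnessOnClique ↔ ¬ Even (chase m v f).val := by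
  have h1 : pathInstance K m hK v f ∈ disjointnessOnClique ↔
      ∀ i : Fin (K ^ m), ∃ u : Fin (K ^ m), ¬ ∀ j : Fin m, j.val = u.val →
    f j ((Fin.cons v (finFunctionFinEquiv.symm i) : Fin (m + 1) → Fin K) j.castSucc) =
      finFunctionFinEquiv.symm i j ∧
    Even ((Fin.cons v (finFunctionFinEquiv.symm i) : Fin (m + 1) → Fin K) (Fin.last m)).val := by
    constructor
    · rintro ⟨-, -, h⟩ i
      obtain ⟨u, hu⟩ := h i.val i.isLt
      refine ⟨u, ?_⟩
      simpa [pathInstance, List.getElem?_ofFn] using hu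
    · intro h
      refine ⟨rfl, fun u => by simp [pathInstance], fun i hi => ?_⟩
      obtain ⟨u, hu⟩ := h ⟨i, hi⟩
      refine ⟨u, ?_⟩
      have hi' : i < K ^ m := hi
      simpa [pathInstance, List.getElem?_ofFn, hi'] using hu
  rw [h1]
  constructor
  · intro h he
    obtain ⟨a, ha⟩ := exists_isPath v f
    obtain ⟨u, hu⟩ := h (finFunctionFinEquiv a)
    refine hu fun j _ => ?_
    rw [Equiv.symm_apply_apply]
    exact ⟨ha j, by rwa [ha.last]⟩
  · intro he i
    by_contra! h
    -- Only the nodes below `m` constrain the coordinate; for the others the condition is vacuous,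
    -- so their bit is `1`.
    have h' : ∀ j : Fin m, _ := fun j => h (Fin.castLE hmK j) j rfl
    have hp : IsPath v f (finFunctionFinEquiv.symm i) := fun j => (h' j).1
    have := (h' ⟨0, hm⟩).2
    rw [hp.last] at this
    exact he this

theorem pathInstance_initialKnowledge_congr (K m : ℕ) (hK : 0 < K) (v : Fin K)
    (f f' : Fin m → Fin K → Fin K) (id : Fin (K ^ m) → ℕ) (u : Fin (K ^ m))
    (h : ∀ j : Fin m, j.val = u.val → f j = f' j) :
    initialKnowledge (pathInstance K m hK v f) id u =
      initialKnowledge (pathInstance K m hK v f') id u := by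
  have : (pathInstance K m hK v f).label u = (pathInstance K m hK v f').label u := by
    unfold pathInstance
    refine congrArg List.ofFn (funext fun i => ?_)
    refine decide_eq_decide.2 (forall_congr' fun j => forall_congr' fun hj => ?_)
    rw [h j hj]
  unfold initialKnowledge
  congr 1

end PathInstance

/-! ### The one-round CONGEST algorithm. -/

/-- The rank of `i` among the identifiers known to a node, its own one included. -/
def Knowledge.rank (K : Knowledge) (i : ℕ) : ℕ := ((insert K.id K.nbrs).filter (· < i)).card

/-- Every node sends the `i`-th bit of its label to the node of rank `i`, which accepts if one of the
bits it gets or its own one is `0`. -/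
def cliqueAlgorithm : CONGESTAlgorithm where
  send K _ j := [K.label.getD (K.rank j) false]
  accept K h := decide (K.nbrs.card + 1 = K.size ∧ K.label.length = K.size ∧
    (K.label[K.rank K.id]? = some false ∨ ∃ s ∈ h, ∃ p ∈ s, p.2 = [false]))

theorem eq_top_iff_card_nbrs (I : LabeledGraph) (id : Fin I.n → ℕ) (hid : Function.Injective id) :
    I.graph = ⊤ ↔ ∀ v, (initialKnowledge I id v).nbrs.card + 1 = (initialKnowledge I id v).size := by
  classical
  have hc : ∀ v, (initialKnowledge I id v).nbrs.card =
      (univ.filter fun u => I.graph.Adj v u).card := by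
    intro v
    simp only [initialKnowledge]
    rw [card_image_of_injective _ hid]
  have hs : ∀ v : Fin I.n, (univ.filter fun u => u ≠ v).card + 1 = I.n := by
    intro v
    rw [filter_ne', card_erase_of_mem (mem_univ v), card_univ, Fintype.card_fin]
    have := I.pos
    omega
  constructor
  · intro h v
    rw [hc, h]
    simp only [SimpleGraph.top_adj, initialKnowledge]
    simpa only [ne_comm] using hs v
  · intro h
    ext v u
    rw [SimpleGraph.top_adj]
    refine ⟨fun a => a.ne, fun huv => ?_⟩
    have hsub : (univ.filter fun u => I.graph.Adj v u) ⊆ univ.filter fun u => u ≠ v := by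
      intro u hu
      simp only [mem_filter, mem_univ, true_and] at hu ⊢
      exact hu.ne'
    have he := eq_of_subset_of_card_le hsub (by
      have h1 := h v
      rw [hc] at h1
      have h2 := hs v
      simp only [initialKnowledge] at h1
      omega)
    have : u ∈ univ.filter fun u => u ≠ v := by simpa using huv.symm
    rw [← he] at this
    simpa using this

theorem rank_initialKnowledge (I : LabeledGraph) (id : Fin I.n → ℕ) (h : I.graph = ⊤)
    (v : Fin I.n) (i : ℕ) :
    (initialKnowledge I id v).rank i = ((univ.image id).filter (· < i)).card := by
  classical
  unfold Knowledge.rank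
  congr 2
  ext x
  simp only [initialKnowledge, h, SimpleGraph.top_adj, mem_insert, mem_image, mem_filter, mem_univ,
    true_and]
  constructor
  · rintro (rfl | ⟨u, -, rfl⟩)
    · exact ⟨v, rfl⟩
    · exact ⟨u, rfl⟩
  · rintro ⟨u, rfl⟩
    by_cases hu : v = u
    · exact Or.inl (by rw [hu])
    · exact Or.inr ⟨u, hu, rfl⟩

theorem rank_lt {n : ℕ} (id : Fin n → ℕ) (hid : Function.Injective id) (v : Fin n) :
    ((univ.image id).filter (· < id v)).card < n := by
  have h1 : (univ.image id).card = n := by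
    rw [card_image_of_injective _ hid, card_univ, Fintype.card_fin]
  calc _ < (univ.image id).card := card_lt_card (by
        rw [filter_ssubset]
        exact ⟨id v, mem_image_of_mem _ (mem_univ v), lt_irrefl _⟩)
    _ = n := h1

/-- Ranks form an injection of `Fin n` into itself, so every coordinate is checked by some node. -/
theorem exists_rank_eq {n : ℕ} (id : Fin n → ℕ) (hid : Function.Injective id) {i : ℕ} (hi : i < n) :
    ∃ v, ((univ.image id).filter (· < id v)).card = i := by
  have hinj : Function.Injective fun v : Fin n =>
      (⟨((univ.image id).filter (· < id v)).card, rank_lt id hid v⟩ : Fin n) := by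
    have hmono : ∀ u v, id u < id v → ((univ.image id).filter (· < id u)).card <
        ((univ.image id).filter (· < id v)).card := by
      intro u v huv
      refine card_lt_card ((ssubset_iff_of_subset ?_).2 ⟨id u, ?_, ?_⟩)
      · exact monotone_filter_right _ fun x _ hx => lt_trans hx huv
      · simpa using huv
      · simp
    intro u v huv
    have huv' := congrArg Fin.val huv
    simp only at huv'
    by_contra hne
    rcases lt_or_gt_of_ne (hid.ne hne) with h | h
    · exact absurd huv' (hmono _ _ h).ne
    · exact absurd huv' (hmono _ _ h).ne'
  obtain ⟨v, hv⟩ := (Finite.injective_iff_surjective.1 hinj) ⟨i, hi⟩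
  exact ⟨v, congrArg Fin.val hv⟩

theorem disjointnessOnClique_mem_classC (N : ℕ → ℕ) : disjointnessOnClique ∈ classC N 1 := by
  classical
  refine ⟨cliqueAlgorithm, ⟨1, fun K h j => by simp [cliqueAlgorithm]⟩, fun I id hid => ?_⟩
  have hid := hid.1
  have hacc : cliqueAlgorithm.AllAccept 1 I id ↔ I.graph = ⊤ ∧ (∀ v, (I.label v).length = I.n) ∧
      ∀ v, (I.label v)[(initialKnowledge I id v).rank (id v)]? = some false ∨
        ∃ u, I.graph.Adj u v ∧ (I.label u).getD ((initialKnowledge I id u).rank (id v)) false =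
          false := by
    rw [eq_top_iff_card_nbrs I id hid, ← forall_and, ← forall_and]
    refine forall_congr' fun v => ?_
    simp only [cliqueAlgorithm, CONGESTAlgorithm.history, decide_eq_true_eq]
    simp [initialKnowledge]
  rw [hacc]
  refine and_congr_right fun hG => and_congr_right fun hlab => ?_
  simp only [rank_initialKnowledge I id hG]
  -- The default `false` is never read here: ranks are below `n`, the common length of the labels.
  have hget : ∀ u v, (I.label u).getD ((univ.image id).filter (· < id v)).card false = false ↔
      (I.label u)[((univ.image id).filter (· < id v)).card]? = some false := by
    intro u v
    rw [List.getD_eq_getElem?_getD, List.getElem?_eq_getElem (by rw [hlab]; exact rank_lt id hid v)]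
    simp
  simp only [hget]
  constructor
  · intro h v
    obtain ⟨u, hu⟩ := h _ (rank_lt id hid v)
    by_cases huv : u = v
    · subst huv; exact Or.inl hu
    · exact Or.inr ⟨u, by rw [hG]; exact huv, hu⟩
  · intro h i hi
    obtain ⟨v, rfl⟩ := exists_rank_eq id hid hi
    rcases h v with h | ⟨u, -, h⟩
    · exact ⟨v, h⟩
    · exact ⟨u, h⟩

/-! ### Choice of parameters and the BCC lower bound. -/

theorem exists_exp_mul_pow_lt (κ A ε : ℝ) (hκ : 0 < κ) (hε : 0 < ε) (α β : ℕ) :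
    ∃ q : ℕ, 1 ≤ q ∧ A * Real.exp (-(κ * 2 ^ q)) * 3 ^ (α * q + β) < ε := by
  have h1 : Filter.Tendsto (fun q : ℕ => κ * (2 : ℝ) ^ q) Filter.atTop Filter.atTop :=
    (tendsto_pow_atTop_atTop_of_one_lt one_lt_two).const_mul_atTop hκ
  have h2 := ((Real.tendsto_pow_mul_exp_neg_atTop_nhds_zero (2 * α)).comp h1).const_mul
    (|A| * 3 ^ β / κ ^ (2 * α))
  rw [mul_zero] at h2
  obtain ⟨q, hq, hq1⟩ := ((h2.eventually (gt_mem_nhds hε)).and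
    (Filter.eventually_ge_atTop 1)).exists
  refine ⟨q, hq1, lt_of_le_of_lt ?_ hq⟩
  simp only [Function.comp]
  -- The base `3` is the size of `Option Bool`. With `K = 2 ^ q` the power is polynomial in `K`,
  -- hence beaten by `exp (-κ K)`.
  have h3 : (3 : ℝ) ^ (α * q) ≤ (2 ^ q) ^ (2 * α) := by
    calc (3 : ℝ) ^ (α * q) ≤ (2 ^ 2) ^ (α * q) := by gcongr; norm_num
      _ = (2 ^ q) ^ (2 * α) := by rw [← pow_mul, ← pow_mul]; congr 1; ring
  calc A * Real.exp (-(κ * 2 ^ q)) * 3 ^ (α * q + β)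
      ≤ |A| * Real.exp (-(κ * 2 ^ q)) * ((2 ^ q) ^ (2 * α) * 3 ^ β) := by
        rw [pow_add]
        gcongr
        exact le_abs_self A
    _ = _ := by
        rw [mul_pow]
        field_simp

theorem sum_neg_one_pow_val {K : ℕ} (hK : Even K) : ∑ u : Fin K, (-1 : ℝ) ^ u.val = 0 := by
  rw [← Finset.sum_range fun i => (-1 : ℝ) ^ i, neg_one_geom_sum, if_pos hK]

open Classical in
/-- The decisions of a BCC algorithm with a given number of rounds and a given bandwidth are
almost uncorrelated with membership in `disjointnessOnClique` on some `pathInstance`s. -/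
theorem exists_abs_sum_pathInstance_lt (T c : ℕ) (ε : ℝ) (hε : 0 < ε) :
    ∃ (K m : ℕ) (hK : 0 < K) (v : Fin K), 0 < m ∧ m ≤ K ^ m ∧
      ∀ A : BCCAlgorithm, A.HasBandwidth c →
        |∑ f, (-1 : ℝ) ^ (chase m v f).val *
          (if A.AllAccept T (pathInstance K m hK v f) (fun u => u.val + 1) then 1 else -1)| <
        ε * Fintype.card (Fin m → Fin K → Fin K) := by
  set m := T + 2 with hm
  set t : ℝ := min ε 1 / (2 ^ (T + 3)) with ht
  have ht0 : 0 < t := by positivity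
  have ht1 : t ≤ 1 := by
    rw [ht, div_le_one (by positivity)]
    exact (min_le_right _ _).trans (one_le_pow₀ one_le_two)
  have htε : 2 ^ (T + 2) * t ≤ ε / 2 := by
    have : 2 ^ (T + 2) * t = min ε 1 / 2 := by
      rw [ht, pow_succ (2 : ℝ) (T + 2)]
      field_simp
    rw [this]
    gcongr
    exact min_le_left _ _
  obtain ⟨q, hq1, hq⟩ := exists_exp_mul_pow_lt (t ^ 2 / 16) (2 ^ (T + 2) * (8 / t)) (ε / 2)
    (by positivity) (by positivity) (c * m * m ^ 2) ((c + 1) * m ^ 2)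
  set K := 2 ^ q with hKdef
  have hK : 0 < K := by positivity
  have hK2 : 2 ≤ K := by
    rw [hKdef]; exact Nat.le_self_pow (by omega) 2
  have : NeZero K := ⟨hK.ne'⟩
  set θ : ℝ := 8 / t * Real.exp (-(t ^ 2 * Fintype.card (Fin K) / 16)) with hθ
  have hθ0 : 0 ≤ θ := by positivity
  set M := Fin (c * (Nat.log 2 (K ^ m) + 1) + 1) → Option Bool with hM
  set F : ℝ := (Fintype.card (Fin K → Fin K) : ℝ) with hF
  have hF0 : 0 < F := by
    rw [hF]; exact_mod_cast Fintype.card_pos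
  set L : ℝ := (Fintype.card M : ℝ) with hL
  have hLq : L ^ (m ^ 2) = 3 ^ (c * m * m ^ 2 * q + (c + 1) * m ^ 2) := by
    have : Nat.log 2 (K ^ m) = q * m := by
      rw [hKdef, ← pow_mul, Nat.log_pow one_lt_two]
    simp only [hL, hM, Fintype.card_fun, Fintype.card_option, Fintype.card_bool, Fintype.card_fin,
      this]
    push_cast
    rw [← pow_mul]
    norm_num
    ring
  have hL1 : 1 ≤ L ^ (m ^ 2) := by rw [hLq]; exact one_le_pow₀ (by norm_num)
  have hsmall : 2 ^ (T + 2) * θ * L ^ (m ^ 2) < ε / 2 := by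
    refine lt_of_eq_of_lt ?_ hq
    rw [hLq, hθ, Fintype.card_fin, hKdef]
    push_cast
    rw [show t ^ 2 * 2 ^ q / 16 = t ^ 2 / 16 * 2 ^ q by ring]
    ring
  have H := fun w h0 h1 => sum_dev_le (V := Fin K) t ht0 ht1 w h0 h1
  -- The full density in fact has zero deviation everywhere, but the averaged bound suffices.
  obtain ⟨v, -, hv⟩ := exists_le_of_sum_le (s := (univ : Finset (Fin K))) univ_nonempty
    (f := fun v => dev (fun _ => 1) v) (g := fun _ => t * F + θ * F) (by
      refine (H (fun _ => 1) (fun _ => zero_le_one) fun _ => le_rfl).trans (le_of_eq ?_)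
      simp [hF, hθ]
      ring)
  refine ⟨K, m, hK, v, by omega, ?_, fun A hA => ?_⟩
  · exact (Nat.lt_two_pow_self).le.trans (Nat.pow_le_pow_left hK2 m)
  have hmK : m ≤ K ^ m := (Nat.lt_two_pow_self).le.trans (Nat.pow_le_pow_left hK2 m)
  have hprot := A.isProtocol_allAccept c hA (fun u : Fin (K ^ m) => u.val + 1)
    (fun (f : Fin m → Fin K → Fin K) =>
      initialKnowledge (pathInstance K m hK v f) (fun u => u.val + 1)) (fun _ _ => rfl)
    (Fin.castLE hmK) (Fin.castLE_injective hmK) (fun f f' u h =>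
      pathInstance_initialKnowledge_congr K m hK v f f' _ u fun j hj => h j (Fin.ext hj))
    T (fun _ => [])
  have hb := abs_sum_chase_mul_le (M := M) (fun u : Fin K => (-1 : ℝ) ^ u.val) (by simp)
    (sum_neg_one_pow_val ((Nat.even_pow' (by omega)).2 even_two)) t θ ht0.le hθ0 H (T + 1) v
    (fun _ _ => 1) _ (fun _ _ => zero_le_one) (fun _ _ => le_rfl) hprot
  have hall : ∀ f, A.AllAccept T (pathInstance K m hK v f) (fun u => u.val + 1) ↔
      ∀ u, A.accept (initialKnowledge (pathInstance K m hK v f) (fun u => u.val + 1) u)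
        ((A.step (initialKnowledge (pathInstance K m hK v f) (fun u => u.val + 1))
          (fun u => u.val + 1))^[T] (fun _ => []) u) = true := by
    intro f
    unfold BCCAlgorithm.AllAccept
    rw [BCCAlgorithm.history_eq_iterate]
  simp only [hall]
  simp only [prod_const_one, one_mul, sum_const, card_univ, nsmul_eq_mul, mul_one, prod_const,
    Fintype.card_fin] at hb
  have hcard : (Fintype.card (Fin m → Fin K → Fin K) : ℝ) = F ^ m := by
    rw [Fintype.card_fun, Fintype.card_fin, Nat.cast_pow]
  rw [hcard]
  refine lt_of_le_of_lt hb ?_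
  have hv' : dev (fun _ => (1 : ℝ)) v ≤ t * F + θ * F := hv
  have hFm : 0 < F ^ m := by positivity
  calc 2 ^ (T + 1) * dev (fun _ => 1) v * F ^ (T + 1) + 2 ^ (T + 1) * t * F ^ m +
        2 ^ (T + 1) * θ * L ^ (m ^ 2) * F ^ m
      ≤ 2 ^ (T + 1) * (t * F + θ * F) * F ^ (T + 1) + 2 ^ (T + 1) * t * F ^ m +
        2 ^ (T + 1) * θ * L ^ (m ^ 2) * F ^ m := by gcongr
    _ = (2 ^ (T + 2) * t + 2 ^ (T + 1) * θ * 1 + 2 ^ (T + 1) * θ * L ^ (m ^ 2)) * F ^ m := by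
        rw [hm]; ring
    _ ≤ (2 ^ (T + 2) * t + 2 ^ (T + 1) * θ * L ^ (m ^ 2) + 2 ^ (T + 1) * θ * L ^ (m ^ 2)) *
        F ^ m := by gcongr
    _ = (2 ^ (T + 2) * t + 2 ^ (T + 2) * θ * L ^ (m ^ 2)) * F ^ m := by ring
    _ < ε * F ^ m := by
        gcongr
        linarith

-- Yao's argument: for each `ω` the deterministic algorithm errs on at least a fraction `(1 - ε) /
-- 2` of the inputs `f`, so the average error exceeds `1 / 2 - ε`.
open MeasureTheory in
theorem disjointnessOnClique_notMem_classBRandStar (N : ℕ → ℕ) (hN : IsIdBound N) (ε : ℝ)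
    (hε : 0 < ε) : disjointnessOnClique ∉ classBRandStar N (1 / 2 - ε) := by
  classical
  intro h
  obtain ⟨T, Ω, _, μ, _, A, ⟨c, hc⟩, hA⟩ := Set.mem_iUnion.1 h
  obtain ⟨K, m, hK, v, hm, hmK, hsum⟩ := exists_abs_sum_pathInstance_lt T c ε hε
  set I := pathInstance K m hK v with hI
  have hid : ∀ f, IsIdAssignment N (I f) (fun u => u.val + 1) := by
    intro f
    refine ⟨fun u u' h => Fin.ext (Nat.succ_injective h), fun u => ⟨Nat.succ_pos _, ?_⟩⟩
    exact (Nat.succ_le_of_lt u.isLt).trans (hN.1 _)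
  set S : (Fin m → Fin K → Fin K) → Set Ω :=
    fun f => {ω | (A ω).AllAccept T (I f) (fun u => u.val + 1)} with hS
  set E : (Fin m → Fin K → Fin K) → Set Ω := fun f =>
    {ω | ¬ (I f ∈ disjointnessOnClique ↔ (A ω).AllAccept T (I f) (fun u => u.val + 1))} with hE
  have hSm : ∀ f, MeasurableSet (S f) := fun f => (hA (I f) _ (hid f)).1
  have hEm : ∀ f, MeasurableSet (E f) := by
    intro f
    by_cases hf : I f ∈ disjointnessOnClique
    · have : E f = (S f)ᶜ := by ext; simp [hE, hS, hf]
      exact this ▸ (hSm f).compl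
    · have : E f = S f := by ext; simp [hE, hS, hf]
      exact this ▸ hSm f
  have hEδ : ∀ f, μ.real (E f) ≤ 1 / 2 - ε := fun f => (hA (I f) _ (hid f)).2
  set C : ℝ := (Fintype.card (Fin m → Fin K → Fin K) : ℝ) with hC
  have hC0 : 0 < C := by
    have : NeZero K := ⟨hK.ne'⟩
    rw [hC]; exact_mod_cast Fintype.card_pos
  have hind : ∀ ω, (1 - ε) / 2 * C ≤ ∑ f, (E f).indicator (1 : Ω → ℝ) ω := by
    intro ω
    -- An even end means a non-member, so sign and decision have product `1` exactly on errors.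
    have e : ∀ f, (E f).indicator (1 : Ω → ℝ) ω = 1 / 2 + 1 / 2 * ((-1 : ℝ) ^ (chase m v f).val *
        (if (A ω).AllAccept T (I f) (fun u => u.val + 1) then 1 else -1)) := by
      intro f
      have hmem : I f ∈ disjointnessOnClique ↔ ¬ Even (chase m v f).val :=
        pathInstance_mem_iff K m hK hm hmK v f
      rw [Set.indicator_apply]
      simp only [hE, Set.mem_ofPred_eq, hmem, Pi.one_apply]
      by_cases h1 : Even (chase m v f).val
      · by_cases h2 : (A ω).AllAccept T (I f) (fun u => u.val + 1) <;>
          simp [h1, h2, h1.neg_one_pow] <;> norm_num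
      · have h1' := (Nat.not_even_iff_odd.1 h1).neg_one_pow (α := ℝ)
        by_cases h2 : (A ω).AllAccept T (I f) (fun u => u.val + 1) <;>
          simp only [h1, h2, h1'] <;> norm_num
    simp only [e, sum_add_distrib, ← mul_sum, sum_const, card_univ, nsmul_eq_mul, ← hC]
    have := (abs_lt.1 (hsum (A ω) (hc ω))).1
    linarith
  have hint : ∀ f, Integrable ((E f).indicator (1 : Ω → ℝ)) μ := fun f =>
    (integrable_const (1 : ℝ)).indicator (hEm f)
  have h1 : (1 - ε) / 2 * C ≤ ∑ f, μ.real (E f) := by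
    have h2 := integral_mono (μ := μ) (integrable_const ((1 - ε) / 2 * C))
      (integrable_finsetSum univ fun f _ => hint f) hind
    rw [integral_finsetSum _ fun f _ => hint f] at h2
    simpa [integral_indicator_one (hEm _)] using h2
  have h3 : ∑ f, μ.real (E f) ≤ C * (1 / 2 - ε) := by
    refine (sum_le_sum fun f _ => hEδ f).trans (le_of_eq ?_)
    rw [sum_const, card_univ, nsmul_eq_mul]
  nlinarith

theorem classB_subset_classBRand (N : ℕ → ℕ) (δ : ℝ) (hδ : 0 ≤ δ) (T : ℕ) :
    classB N T ⊆ classBRand N δ T := by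
  rintro L ⟨A, ⟨c, hc⟩, hA⟩
  refine ⟨Unit, inferInstance, MeasureTheory.Measure.dirac (), inferInstance, fun _ => A,
    ⟨c, fun _ => hc⟩, fun I id hid => ⟨MeasurableSet.of_discrete, ?_⟩⟩
  have : {ω : Unit | ¬ (I ∈ L ↔ A.AllAccept T I id)} = ∅ := by
    ext; simp [hA I id hid]
  rw [this]
  simpa using hδ

theorem classBStar_subset_classBRandStar (N : ℕ → ℕ) (δ : ℝ) (hδ : 0 ≤ δ) :
    classBStar N ⊆ classBRandStar N δ :=
  Set.iUnion_mono fun T => classB_subset_classBRand N δ hδ T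

end HybridModels

theorem mainTheorem6 (N : ℕ → ℕ) (hN : HybridModels.IsIdBound N) :
    HybridModels.disjointnessOnClique ∈
        HybridModels.classC N 1 \ HybridModels.classBStar N ∧
      ∀ ε : ℝ, 0 < ε →
        HybridModels.disjointnessOnClique ∈
          HybridModels.classC N 1 \ HybridModels.classBRandStar N (1 / 2 - ε) := by
  have hC := HybridModels.disjointnessOnClique_mem_classC N
  have hB := HybridModels.disjointnessOnClique_notMem_classBRandStar N hN
  refine ⟨⟨hC, fun h => hB (1 / 4) (by norm_num) ?_⟩, fun ε hε => ⟨hC, hB ε hε⟩⟩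
  exact HybridModels.classBStar_subset_classBRandStar N _ (by norm_num) h
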